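/- Let $(A,G,\delta)$ be a C*-dynamical system with $G$ compact: $A$ is a C*-algebra, $G$ is a compact Hausdorff group, and $\delta : G \to \mathrm{Aut}(A)$ is a homomorphism such that $g \mapsto \delta_g(a)$ is norm continuous for every $a \in A$. For a subgroup $K \subset G$ put $A^K = \{a \in A : \delta_g(a) = a \text{ for all } g \in K\}$. Let $B$ be a C*-subalgebra of $A$ with $A^G \subset B \subset A$ that is $G$-invariant, i.e. $\delta_g(B) \subset B$ for all $g \in G$. Put $G^B = \{g \in G : \delta_g(b) = b \text{ for all } b \in B\}$, a closed normal subgroup of $G$, and let $\delta^\bullet$ be the action of $G/G^B$ on $B$ induced by $\delta$. A C*-dynamical system $(C,H,\alpha)$ with $H$ compact is called saturated if the closed two-sided ideal of the crossed product $C \rtimes_\alpha H$ generated by the character of the trivial representation of $H$ (the constant function $1$ on $H$, regarded as a multiplier of $C \rtimes_\alpha H$) is equal to $C \rtimes_\alpha H$. 1. If $(B,G,\delta|_B)$ is saturated and $\delta|_B$ is faithful, i.e. $g \mapsto \delta_g|_B$ is injective, then $B = A$. 2. If $(B, G/G^B, \delta^\bullet)$ is saturated, then $B = A^{G^B}$.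 -/

import Mathlib

open MeasureTheory
open scoped ENNReal

universe u v

/-- A C*-dynamical system `(A, G, δ)`: a homomorphism `δ` of the topological group `G` into the
group of *-automorphisms of the C*-algebra `A` such that `g ↦ δ g a` is norm continuous for every
`a`. -/
structure CStarAction (G : Type u) [Group G] [TopologicalSpace G]
    (A : Type v) [NonUnitalCStarAlgebra A] where
  /-- The underlying homomorphism into the automorphism group. -/
  act : G →* (A ≃⋆ₐ[ℂ] A)
  continuous_act : ∀ a : A, Continuous fun g : G => act g a

/-- The normalized Haar measure of a compact group (total mass `1`), on its Borel sets. -/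
noncomputable def normalizedHaar (G : Type u) [Group G] [TopologicalSpace G]
    [IsTopologicalGroup G] [CompactSpace G] : @Measure G (borel G) :=
  letI : MeasurableSpace G := borel G
  haveI : BorelSpace G := ⟨rfl⟩
  Measure.haarMeasure (⊤ : TopologicalSpace.PositiveCompacts G)

theorem normalizedHaar_univ (G : Type u) [Group G] [TopologicalSpace G]
    [IsTopologicalGroup G] [CompactSpace G] : normalizedHaar G Set.univ = 1 := by
  let _ : MeasurableSpace G := borel G
  have _ : BorelSpace G := ⟨rfl⟩
  have h := Measure.haarMeasure_self (G := G) (K₀ := ⊤)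
  simpa [normalizedHaar] using h

/-- A continuous function with values in a Banach space is integrable over a compact group. -/
theorem integrable_normalizedHaar {G : Type u} [Group G] [TopologicalSpace G]
    [IsTopologicalGroup G] [CompactSpace G] {E : Type*} [NormedAddCommGroup E]
    {f : G → E} (hf : Continuous f) :
    Integrable f (normalizedHaar G) := by
  let _ : MeasurableSpace G := borel G
  have _ : BorelSpace G := ⟨rfl⟩
  have _ : IsFiniteMeasure (normalizedHaar G) := ⟨by rw [normalizedHaar_univ]; simp⟩
  exact hf.integrable_of_hasCompactSupport (HasCompactSupport.of_compactSpace f)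

/-- If `‖f g‖ ≤ C` on a compact group, then the normalized Haar integral of `f` has norm at
most `C`. -/
theorem norm_integral_normalizedHaar_le {G : Type u} [Group G] [TopologicalSpace G]
    [IsTopologicalGroup G] [CompactSpace G] {E : Type*} [NormedAddCommGroup E]
    [NormedSpace ℝ E] {f : G → E} {C : ℝ} (h : ∀ g, ‖f g‖ ≤ C) :
    ‖∫ g, f g ∂(normalizedHaar G)‖ ≤ C := by
  let _ : MeasurableSpace G := borel G
  have _ : IsFiniteMeasure (normalizedHaar G) := ⟨by rw [normalizedHaar_univ]; simp⟩
  have := norm_integral_le_of_norm_le_const (μ := normalizedHaar G) (f := f)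
    (Filter.Eventually.of_forall h)
  simpa [Measure.real, normalizedHaar_univ] using this

namespace CStarAction

section Systems

variable {G : Type u} [Group G] [TopologicalSpace G] {A : Type v} [NonUnitalCStarAlgebra A]

/-- `δ` is faithful: only the identity of `G` acts trivially. -/
def IsFaithful (δ : CStarAction G A) : Prop := Function.Injective δ.act

/-- The subalgebra `A ^ K` of the elements of `A` fixed by every element of the subgroup `K`. -/
def fixedAlgebra (δ : CStarAction G A) (K : Subgroup G) : NonUnitalStarSubalgebra ℂ A where
  carrier := {a | ∀ g ∈ K, δ.act g a = a}
  add_mem' := fun ha hb g hg => by rw [map_add, ha g hg, hb g hg]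
  zero_mem' := fun g _ => map_zero _
  mul_mem' := fun ha hb g hg => by rw [map_mul, ha g hg, hb g hg]
  smul_mem' := fun c a ha g hg => by rw [map_smul, ha g hg]
  star_mem' := fun ha g hg => by rw [map_star, ha g hg]

/-- `B` is globally invariant under the action. -/
def IsInvariant (δ : CStarAction G A) (B : NonUnitalStarSubalgebra ℂ A) : Prop :=
  ∀ g : G, ∀ b ∈ B, δ.act g b ∈ B

/-- The action of `G` on an invariant C*-subalgebra `B` obtained by restriction. -/
noncomputable def restrict (δ : CStarAction G A) (B : NonUnitalStarSubalgebra ℂ A)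
    [IsClosed (B : Set A)] (hB : δ.IsInvariant B) : CStarAction G B where
  act :=
    { toFun := fun g =>
        { toFun := fun b => ⟨δ.act g b, hB g b b.2⟩
          invFun := fun b => ⟨δ.act g⁻¹ b, hB g⁻¹ b b.2⟩
          left_inv := fun b => Subtype.ext <| by
            change (δ.act g⁻¹ * δ.act g) (b : A) = b
            rw [← map_mul, inv_mul_cancel, map_one]; rfl
          right_inv := fun b => Subtype.ext <| by
            change (δ.act g * δ.act g⁻¹) (b : A) = b
            rw [← map_mul, mul_inv_cancel, map_one]; rfl
          map_mul' := fun a b => Subtype.ext (map_mul (δ.act g) (a : A) b)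
          map_add' := fun a b => Subtype.ext (map_add (δ.act g) (a : A) b)
          map_star' := fun a => Subtype.ext (map_star (δ.act g) (a : A))
          map_smul' := fun c a => Subtype.ext (map_smul (δ.act g) c (a : A)) }
      map_one' := by
        ext b
        change δ.act 1 (b : A) = b
        rw [map_one]; rfl
      map_mul' := fun g h => by
        ext b
        change δ.act (g * h) (b : A) = (δ.act g * δ.act h) (b : A)
        rw [map_mul] }
  continuous_act := fun b => (δ.continuous_act (b : A)).subtype_mk _

@[simp] theorem coe_restrict_act (δ : CStarAction G A) (B : NonUnitalStarSubalgebra ℂ A)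
    [IsClosed (B : Set A)] (hB : δ.IsInvariant B) (g : G) (b : B) :
    ((δ.restrict B hB).act g b : A) = δ.act g b := rfl

/-- The subgroup of the elements of `G` that act trivially on all of `A`. -/
def kernel (δ : CStarAction G A) : Subgroup G where
  carrier := {g | ∀ a, δ.act g a = a}
  one_mem' := fun a => by rw [map_one]; rfl
  mul_mem' := fun {g h} hg hh a => by
    rw [map_mul]
    change δ.act g (δ.act h a) = a
    rw [hh a, hg a]
  inv_mem' := fun {g} hg a => by
    have h : (δ.act g⁻¹ * δ.act g) a = a := by
      rw [← map_mul, inv_mul_cancel, map_one]; rfl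
    change δ.act g⁻¹ (δ.act g a) = a at h
    rwa [hg a] at h

theorem kernel_eq_ker (δ : CStarAction G A) : δ.kernel = δ.act.ker := by
  ext g
  rw [MonoidHom.mem_ker, StarAlgEquiv.ext_iff]
  rfl

instance kernel_normal (δ : CStarAction G A) : δ.kernel.Normal := by
  rw [kernel_eq_ker]; infer_instance

/-- The faithful action of `G ⧸ δ.kernel` induced by `δ`. -/
def quotient (δ : CStarAction G A) : CStarAction (G ⧸ δ.kernel) A where
  act := QuotientGroup.lift δ.kernel δ.act (kernel_eq_ker δ).le
  continuous_act := fun a => by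
    refine continuous_coinduced_dom.2 ?_
    exact δ.continuous_act a

@[simp] theorem quotient_act_mk (δ : CStarAction G A) (g : G) (a : A) :
    δ.quotient.act (g : G ⧸ δ.kernel) a = δ.act g a := rfl

/-- The group `G ^ B` of the elements of `G` that fix every element of `B`; for an invariant `B`
it is the subgroup of the elements that act trivially on `B`. -/
noncomputable def fixator (δ : CStarAction G A) (B : NonUnitalStarSubalgebra ℂ A)
    [IsClosed (B : Set A)] (hB : δ.IsInvariant B) : Subgroup G :=
  (δ.restrict B hB).kernel

theorem mem_fixator (δ : CStarAction G A) (B : NonUnitalStarSubalgebra ℂ A)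
    [IsClosed (B : Set A)] (hB : δ.IsInvariant B) (g : G) :
    g ∈ δ.fixator B hB ↔ ∀ b ∈ B, δ.act g b = b :=
  ⟨fun h b hb => congrArg Subtype.val (h ⟨b, hb⟩), fun h b => Subtype.ext (h b b.2)⟩

instance fixator_normal (δ : CStarAction G A) (B : NonUnitalStarSubalgebra ℂ A)
    [IsClosed (B : Set A)] (hB : δ.IsInvariant B) : (δ.fixator B hB).Normal :=
  (δ.restrict B hB).kernel_normal

/-- The quotient action `δ•` of `G ⧸ G ^ B` on the invariant C*-subalgebra `B`. -/
noncomputable def quotientRestrict (δ : CStarAction G A) (B : NonUnitalStarSubalgebra ℂ A)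
    [IsClosed (B : Set A)] (hB : δ.IsInvariant B) :
    CStarAction (G ⧸ δ.fixator B hB) B :=
  (δ.restrict B hB).quotient

end Systems

/-- A covariant representation of `(A, G, δ)` on a Hilbert space: a *-representation `π` of `A` and
a strongly continuous unitary representation `U` of `G` with `U g π(a) (U g)* = π(δ g a)`. -/
structure CovariantRep {G : Type u} [Group G] [TopologicalSpace G] {A : Type v}
    [NonUnitalCStarAlgebra A] (δ : CStarAction G A) where
  /-- The Hilbert space; up to unitary equivalence, every cyclic representation lives here. -/
  H : Type (max u v)
  [instNorm : NormedAddCommGroup H]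
  [instInner : InnerProductSpace ℂ H]
  [instComplete : CompleteSpace H]
  /-- The representation of the algebra. -/
  π : A →⋆ₙₐ[ℂ] (H →L[ℂ] H)
  /-- The representation of the group. -/
  U : G →* unitary (H →L[ℂ] H)
  continuous_U : ∀ ξ : H, Continuous fun g : G => (U g : H →L[ℂ] H) ξ
  covariant : ∀ (g : G) (a : A),
    (U g : H →L[ℂ] H) * π a * star (U g : H →L[ℂ] H) = π (δ.act g a)

attribute [instance] CovariantRep.instNorm CovariantRep.instInner CovariantRep.instComplete

section CrossedProduct

variable {G : Type u} [Group G] [TopologicalSpace G] {A : Type v} [NonUnitalCStarAlgebra A]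

namespace CovariantRep

variable {δ : CStarAction G A} (ρ : CovariantRep δ)

theorem norm_U_apply (g : G) (ξ : ρ.H) : ‖(ρ.U g : ρ.H →L[ℂ] ρ.H) ξ‖ = ‖ξ‖ :=
  ContinuousLinearMap.norm_map_of_mem_unitary (ρ.U g).2 ξ

theorem norm_π_apply_le (a : A) (ξ : ρ.H) : ‖ρ.π a ξ‖ ≤ ‖a‖ * ‖ξ‖ :=
  ((ρ.π a).le_opNorm ξ).trans
    (mul_le_mul_of_nonneg_right (NonUnitalStarAlgHom.norm_apply_le ρ.π a) (norm_nonneg _))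

theorem continuous_integrand (f : C(G, A)) (ξ : ρ.H) :
    Continuous fun g : G => ρ.π (f g) ((ρ.U g : ρ.H →L[ℂ] ρ.H) ξ) := by
  have hπ : Continuous ρ.π :=
    AddMonoidHomClass.continuous_of_bound ρ.π 1 fun a => by
      simpa using NonUnitalStarAlgHom.norm_apply_le ρ.π a
  exact (hπ.comp f.continuous).clm_apply (ρ.continuous_U ξ)

variable [IsTopologicalGroup G] [CompactSpace G]

/-- The integrated form `(π × U)(f) = ∫ π(f(g)) U g dg` of a covariant representation at a
continuous function `f : G → A`; the integral converges strongly. -/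
noncomputable def integratedForm (f : C(G, A)) : ρ.H →L[ℂ] ρ.H :=
  LinearMap.mkContinuous
    { toFun := fun ξ => ∫ g, ρ.π (f g) ((ρ.U g : ρ.H →L[ℂ] ρ.H) ξ) ∂(normalizedHaar G)
      map_add' := fun ξ η => by
        simp only [map_add]
        exact integral_add (integrable_normalizedHaar (ρ.continuous_integrand f ξ))
          (integrable_normalizedHaar (ρ.continuous_integrand f η))
      map_smul' := fun c ξ => by
        simp only [map_smul, RingHom.id_apply]
        exact integral_smul c _ }
    ‖f‖ fun ξ => norm_integral_normalizedHaar_le fun g =>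
      (ρ.norm_π_apply_le _ _).trans <| by
        rw [norm_U_apply]
        exact mul_le_mul_of_nonneg_right (f.norm_coe_le_norm g) (norm_nonneg _)

theorem integratedForm_apply (f : C(G, A)) (ξ : ρ.H) : ρ.integratedForm f ξ =
    ∫ g, ρ.π (f g) ((ρ.U g : ρ.H →L[ℂ] ρ.H) ξ) ∂(normalizedHaar G) := rfl

theorem norm_integratedForm_le (f : C(G, A)) : ‖ρ.integratedForm f‖ ≤ ‖f‖ :=
  LinearMap.mkContinuous_norm_le _ (norm_nonneg _) _

/-- The operator `∫ φ(g) U g dg` for a continuous scalar function `φ` on `G`. -/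
noncomputable def groupOperator (φ : C(G, ℂ)) : ρ.H →L[ℂ] ρ.H :=
  LinearMap.mkContinuous
    { toFun := fun ξ => ∫ g, φ g • (ρ.U g : ρ.H →L[ℂ] ρ.H) ξ ∂(normalizedHaar G)
      map_add' := fun ξ η => by
        simp only [map_add, smul_add]
        exact integral_add
          (integrable_normalizedHaar (φ.continuous.smul (ρ.continuous_U ξ)))
          (integrable_normalizedHaar (φ.continuous.smul (ρ.continuous_U η)))
      map_smul' := fun c ξ => by
        simp only [map_smul, RingHom.id_apply, smul_comm _ c]
        exact integral_smul c _ }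
    ‖φ‖ fun ξ => norm_integral_normalizedHaar_le fun g => by
      rw [norm_smul, norm_U_apply]
      exact mul_le_mul_of_nonneg_right (φ.norm_coe_le_norm g) (norm_nonneg _)

theorem groupOperator_apply (φ : C(G, ℂ)) (ξ : ρ.H) : ρ.groupOperator φ ξ =
    ∫ g, φ g • (ρ.U g : ρ.H →L[ℂ] ρ.H) ξ ∂(normalizedHaar G) := rfl

theorem norm_groupOperator_le (φ : C(G, ℂ)) : ‖ρ.groupOperator φ‖ ≤ ‖φ‖ :=
  LinearMap.mkContinuous_norm_le _ (norm_nonneg _) _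

end CovariantRep

/-- The C*-algebra of bounded families of operators, one on the Hilbert space of each covariant
representation: the block diagonal operators on the direct sum of all of them. -/
def UniversalOperators (δ : CStarAction G A) : Type (max u v + 1) :=
  lp (fun ρ : CovariantRep δ => ρ.H →L[ℂ] ρ.H) ∞

noncomputable instance (δ : CStarAction G A) : NonUnitalCStarAlgebra (UniversalOperators δ) :=
  inferInstanceAs (NonUnitalCStarAlgebra (lp (fun ρ : CovariantRep δ => ρ.H →L[ℂ] ρ.H) ∞))

variable [IsTopologicalGroup G] [CompactSpace G]

/-- The image of `f : C(G, A)` under the direct sum of all covariant representations. Its norm is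
the universal norm of `f`, the supremum of the norms of its integrated forms. -/
noncomputable def universalForm (δ : CStarAction G A) (f : C(G, A)) : UniversalOperators δ :=
  ⟨fun ρ => ρ.integratedForm f,
    memℓp_infty ⟨‖f‖, by rintro _ ⟨ρ, rfl⟩; exact ρ.norm_integratedForm_le f⟩⟩

/-- The crossed product of `A` by the action `δ` of the compact group `G`: the completion of
`C(G, A)` in the universal norm, realized as the C*-algebra generated by the images of the elements
of `C(G, A)` in the direct sum of all covariant representations. -/
noncomputable def crossedProduct (δ : CStarAction G A) :
    NonUnitalStarSubalgebra ℂ (UniversalOperators δ) :=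
  (NonUnitalStarAlgebra.adjoin ℂ (Set.range δ.universalForm)).topologicalClosure

/-- The multiplier of the crossed product given by a continuous scalar function `φ` on `G`, namely
`∫ φ(g) U g dg` in every covariant representation. -/
noncomputable def groupMultiplier (δ : CStarAction G A) (φ : C(G, ℂ)) : UniversalOperators δ :=
  ⟨fun ρ => ρ.groupOperator φ,
    memℓp_infty ⟨‖φ‖, by rintro _ ⟨ρ, rfl⟩; exact ρ.norm_groupOperator_le φ⟩⟩

/-- The closed two-sided ideal of the crossed product generated by the multiplier `χ` of the
trivial character (the constant function `1`): the closed linear span of the products `x χ y` with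
`x` and `y` in the crossed product. -/
noncomputable def trivialCharacterIdeal (δ : CStarAction G A) :
    Submodule ℂ (UniversalOperators δ) :=
  (Submodule.span ℂ {z | ∃ x ∈ δ.crossedProduct, ∃ y ∈ δ.crossedProduct,
    z = x * δ.groupMultiplier 1 * y}).topologicalClosure

/-- The system is saturated: the closed two-sided ideal of the crossed product generated by the
trivial character is the whole crossed product. -/
def IsSaturated (δ : CStarAction G A) : Prop :=
  (δ.trivialCharacterIdeal : Set (UniversalOperators δ)) = δ.crossedProduct

end CrossedProduct

end CStarAction

/-! Both statements follow from `surjective_of_isSaturated`: an equivariant `ι : C → A` whose closed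
range `W` contains the fixed points is onto as soon as `C` is saturated. For the second statement it
is applied to `G ⧸ K` acting on `A ^ K`, with `K = G ^ B`; the fixed points there are again those of
`G` in `A`.

Let `E` be the average over the group. For a positive functional `τ` on `A`, the functional `τ ∘ E`
is invariant, and its GNS representation, restricted along `ι`, is a covariant representation of `C`
with a map `j` from `A` into its space (`exists_intertwines`). The trivial character acts by `j x ↦
j (E x)`, with `E x ∈ W`, and the crossed product preserves `j W` up to approximation because `W` is
an invariant left `C`-module. So the ideal generated by the character moves `j A` approximately into
`j W`, with approximants that do not depend on the representation. By saturation the element `g ↦ φ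
g • c` does so too, which places `∫ φ g • (ι c * δ g x)` near `W` in all these representations at
once.

These representations only detect `‖E (z* z)‖ ^ (1/2)`, a weaker norm than that of `A`. Smoothing
along orbits compensates: `∫ ψ g • δ g z` is bounded in `A` by that weaker norm
(`norm_integral_smul_act_le`). Letting `ψ`, and then `φ`, concentrate at the identity gives `ι c * x
∈ W`. Finally `E e * x` is close to `x` for a suitable `e` (`exists_norm_average_mul_sub_le`), and
`E e` is itself some `ι c`. -/

/-! ### Haar integration on a compact group. -/

section Haar

variable {G : Type u} [Group G] [TopologicalSpace G] [IsTopologicalGroup G] [CompactSpace G]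
  {E : Type*} [NormedAddCommGroup E] [NormedSpace ℝ E]

theorem integral_normalizedHaar_mul_left (f : G → E) (h : G) :
    ∫ g, f (h * g) ∂(normalizedHaar G) = ∫ g, f g ∂(normalizedHaar G) := by
  let _ : MeasurableSpace G := borel G
  have _ : BorelSpace G := ⟨rfl⟩
  exact integral_mul_left_eq_self (μ := Measure.haarMeasure ⊤) f h

theorem integral_normalizedHaar_const [CompleteSpace E] (c : E) :
    ∫ _ : G, c ∂(normalizedHaar G) = c := by
  let _ : MeasurableSpace G := borel G
  simp [integral_const, Measure.real, normalizedHaar_univ]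

theorem integral_normalizedHaar_mem [CompleteSpace E] {s : Set E} (hs : Convex ℝ s)
    (hc : IsClosed s) {f : G → E} (hf : Continuous f) (hfs : ∀ g, f g ∈ s) :
    ∫ g, f g ∂(normalizedHaar G) ∈ s := by
  let _ : MeasurableSpace G := borel G
  have _ : IsProbabilityMeasure (normalizedHaar G) := ⟨normalizedHaar_univ G⟩
  exact hs.integral_mem hc (Filter.Eventually.of_forall hfs) (integrable_normalizedHaar hf)

theorem integral_normalizedHaar_clm {𝕜 F : Type*} [RCLike 𝕜] [NormedSpace 𝕜 E]
    [NormedAddCommGroup F] [NormedSpace ℝ F] [NormedSpace 𝕜 F] [CompleteSpace E] [CompleteSpace F]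
    (L : E →L[𝕜] F) {f : G → E} (hf : Continuous f) :
    ∫ g, L (f g) ∂(normalizedHaar G) = L (∫ g, f g ∂(normalizedHaar G)) := by
  let _ : MeasurableSpace G := borel G
  exact L.integral_comp_comm (integrable_normalizedHaar hf)

/-- The variance of `‖f‖` under a probability measure is nonnegative; this is the only form of
Cauchy–Schwarz needed. -/
theorem sq_norm_integral_normalizedHaar_le {f : G → E} (hf : Continuous f) :
    ‖∫ g, f g ∂(normalizedHaar G)‖ ^ 2 ≤ ∫ g, ‖f g‖ ^ 2 ∂(normalizedHaar G) := by
  let _ : MeasurableSpace G := borel G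
  set m := ∫ g, ‖f g‖ ∂(normalizedHaar G) with hm
  have h1 : ‖∫ g, f g ∂(normalizedHaar G)‖ ≤ m := norm_integral_le_integral_norm _
  have h2 : 0 ≤ ∫ g, (‖f g‖ - m) ^ 2 ∂(normalizedHaar G) :=
    integral_nonneg fun g => sq_nonneg _
  have h3 : ∫ g, (‖f g‖ - m) ^ 2 ∂(normalizedHaar G)
      = (∫ g, ‖f g‖ ^ 2 ∂(normalizedHaar G)) - m ^ 2 := by
    have e : ∀ g, (‖f g‖ - m) ^ 2 = (‖f g‖ ^ 2 - (2 * m) * ‖f g‖) + m ^ 2 := fun g => by ring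
    simp_rw [e]
    rw [integral_add, integral_sub, integral_const_mul, ← hm, integral_normalizedHaar_const]
    · ring
    all_goals exact integrable_normalizedHaar (by fun_prop)
  nlinarith [norm_nonneg (∫ g, f g ∂(normalizedHaar G))]

/-- Continuous functions concentrate the Haar measure near the identity. -/
theorem exists_integral_smul_near [NormedSpace ℂ E] [CompleteSpace E] {F : G → E}
    (hF : Continuous F) {ε : ℝ} (hε : 0 < ε) :
    ∃ φ : C(G, ℂ), ‖(∫ g, φ g • F g ∂(normalizedHaar G)) - F 1‖ ≤ ε := by
  let _ : MeasurableSpace G := borel G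
  have _ : BorelSpace G := ⟨rfl⟩
  let μ := Measure.haarMeasure (⊤ : TopologicalSpace.PositiveCompacts G)
  have hU : IsOpen {g | ‖F g - F 1‖ < ε} := isOpen_lt (by fun_prop) continuous_const
  obtain ⟨f, hf1, hf0, -, hf⟩ := exists_continuous_one_zero_of_isCompact
    (isCompact_singleton (x := (1 : G))) hU.isClosed_compl
    (by simpa using hε)
  have hpos : 0 < ∫ g, f g ∂(normalizedHaar G) := by
    refine Continuous.integral_pos_of_hasCompactSupport_nonneg_nonzero (μ := μ) f.continuous
      (HasCompactSupport.of_compactSpace f) (fun g => (hf g).1) (x := 1) ?_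
    rw [hf1 rfl]; simp
  set c := ∫ g, f g ∂(normalizedHaar G)
  refine ⟨⟨fun g => ((c⁻¹ * f g : ℝ) : ℂ), by fun_prop⟩, ?_⟩
  have hint : Integrable (fun g => c⁻¹ * f g) (normalizedHaar G) :=
    integrable_normalizedHaar (by fun_prop)
  have h1 : F 1 = ∫ g, ((c⁻¹ * f g : ℝ) : ℂ) • F 1 ∂(normalizedHaar G) := by
    rw [integral_smul_const, integral_complex_ofReal, integral_const_mul,
      inv_mul_cancel₀ hpos.ne']
    simp
  have h2 : (∫ g, ((c⁻¹ * f g : ℝ) : ℂ) • F g ∂(normalizedHaar G)) - F 1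
      = ∫ g, ((c⁻¹ * f g : ℝ) : ℂ) • (F g - F 1) ∂(normalizedHaar G) := by
    conv_lhs => rw [h1]
    rw [← integral_sub]
    · simp_rw [smul_sub]
    all_goals exact integrable_normalizedHaar (by fun_prop)
  change ‖(∫ g, ((c⁻¹ * f g : ℝ) : ℂ) • F g ∂(normalizedHaar G)) - F 1‖ ≤ ε
  rw [h2]
  calc _ ≤ ∫ g, (c⁻¹ * f g) * ε ∂(normalizedHaar G) := by
        refine norm_integral_le_of_norm_le (hint.mul_const _) (Filter.Eventually.of_forall ?_)
        intro g
        have hg : 0 ≤ c⁻¹ * f g := mul_nonneg (inv_nonneg.2 hpos.le) (hf g).1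
        rw [norm_smul, Complex.norm_real, Real.norm_of_nonneg hg]
        by_cases hgU : ‖F g - F 1‖ < ε
        · exact mul_le_mul_of_nonneg_left hgU.le hg
        · have : f g = 0 := hf0 hgU
          simp [this]
    _ = ε := by
        rw [integral_mul_const, integral_const_mul, inv_mul_cancel₀ hpos.ne', one_mul]

end Haar

/-! ### Positive functionals that attain the norm, by Hahn–Banach separation. -/

section NormingFunctional

open scoped ComplexOrder Pointwise

variable {A : Type v} [NonUnitalCStarAlgebra A] [PartialOrder A] [StarOrderedRing A]

/-- The norm of a positive element is attained at a positive functional of norm at most one. -/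
theorem exists_positiveLinearMap_apply_eq_norm (w : A) (hw : 0 ≤ w) :
    ∃ τ : A →ₚ[ℂ] ℂ, (∀ a, 0 ≤ a → (τ a).re ≤ ‖a‖) ∧ (τ w).re = ‖w‖ := by
  rcases eq_or_ne w 0 with rfl | hw0
  · exact ⟨0, by simp, by simp⟩
  have hwn : 0 < ‖w‖ := norm_pos_iff.2 hw0
  have hsub : Convex ℝ {a : A | a ≤ 0} := convex_Iic 0
  -- The point `w` lies outside this open convex set, since `0 ≤ w ≤ c` forces `‖w‖ ≤ ‖c‖`. A
  -- separating functional is bounded above on the negative cone, hence positive, and the ball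
  -- controls its norm.
  have hD : Convex ℝ (Metric.ball (0 : A) ‖w‖ + {a : A | a ≤ 0}) :=
    (convex_ball 0 _).add hsub
  have hDo : IsOpen (Metric.ball (0 : A) ‖w‖ + {a : A | a ≤ 0}) := Metric.isOpen_ball.add_right
  obtain ⟨f, hf⟩ := geometric_hahn_banach_open_point (x := w) hD hDo <| by
    rintro ⟨c, hc, p, hp, rfl⟩
    have h1 : c + p ≤ c := add_le_of_nonpos_right hp
    have := CStarAlgebra.norm_le_norm_of_nonneg_of_le hw h1
    rw [mem_ball_zero_iff] at hc
    exact absurd hc (not_lt.2 this)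
  have hball : ∀ a, ‖a‖ < ‖w‖ → f a < f w := fun a ha =>
    hf a ⟨a, by simpa using ha, 0, le_rfl, add_zero a⟩
  have hfw : 0 < f w := by simpa using hball 0 (by simpa using hwn)
  have hpos : ∀ a, 0 ≤ a → 0 ≤ f a := by
    intro a ha
    by_contra! h
    have := hf ((f w / f a) • a) ⟨0, by simpa using hwn, (f w / f a) • a,
      smul_nonpos_of_nonpos_of_nonneg (div_nonpos_of_nonneg_of_nonpos hfw.le h.le) ha, zero_add _⟩
    rw [map_smul, smul_eq_mul, div_mul_cancel₀ _ h.ne] at this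
    exact lt_irrefl _ this
  have hbd : ∀ a, f a ≤ f w / ‖w‖ * ‖a‖ := by
    intro a
    rw [div_mul_eq_mul_div, le_div_iff₀ hwn]
    rcases eq_or_ne a 0 with rfl | ha
    · simp
    have han : 0 < ‖a‖ := norm_pos_iff.2 ha
    by_contra! h
    have hfa : 0 < f a := by
      by_contra! h'
      nlinarith [mul_nonneg hfw.le han.le]
    have := hball ((f w / f a) • a) <| by
      rw [norm_smul, Real.norm_of_nonneg (by positivity), div_mul_eq_mul_div, div_lt_iff₀ hfa]
      linarith
    rw [map_smul, smul_eq_mul, div_mul_cancel₀ _ hfa.ne'] at this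
    exact lt_irrefl _ this
  -- Symmetrizing under `star` makes the complexification real on self-adjoint elements; the factor
  -- `‖w‖ / (2 * f w)` gives it the value `‖w‖` at `w`.
  let S : A →ₗ[ℝ] A :=
    { toFun := star, map_add' := star_add, map_smul' := fun r a => by simp }
  let h : Module.Dual ℝ A := (‖w‖ / (2 * f w)) • ((f : A →ₗ[ℝ] ℝ) + (f : A →ₗ[ℝ] ℝ) ∘ₗ S)
  have hh : ∀ a, h a = ‖w‖ / (2 * f w) * (f a + f (star a)) := fun a => rfl
  have hsa : ∀ a : A, IsSelfAdjoint a →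
      h.extendRCLike (𝕜 := ℂ) a = ((‖w‖ / f w * f a : ℝ) : ℂ) := by
    intro a ha
    rw [Module.Dual.extendRCLike_apply, hh, hh, star_smul, ha.star_eq]
    have : star (RCLike.I : ℂ) • a = -((RCLike.I : ℂ) • a) := by simp
    rw [this, map_neg, add_neg_cancel]
    simp only [mul_zero, RCLike.ofReal_zero, sub_zero]
    rw [← two_mul, RCLike.ofReal_eq_complex_ofReal]
    congr 1
    field_simp
  have hsa' : ∀ a : A, 0 ≤ a →
      h.extendRCLike (𝕜 := ℂ) a = ((‖w‖ / f w * f a : ℝ) : ℂ) :=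
    fun a ha => hsa a (IsSelfAdjoint.of_nonneg ha)
  refine ⟨PositiveLinearMap.mk₀ (h.extendRCLike (𝕜 := ℂ)) fun a ha => ?_, fun a ha => ?_, ?_⟩
  · rw [hsa' a ha]
    exact Complex.zero_le_real.2 (mul_nonneg (by positivity) (hpos a ha))
  · change (h.extendRCLike (𝕜 := ℂ) a).re ≤ _
    rw [hsa' a ha, Complex.ofReal_re]
    calc _ ≤ ‖w‖ / f w * (f w / ‖w‖ * ‖a‖) :=
          mul_le_mul_of_nonneg_left (hbd a) (by positivity)
      _ = ‖a‖ := by field_simp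
  · change (h.extendRCLike (𝕜 := ℂ) w).re = _
    rw [hsa' w hw, Complex.ofReal_re]
    field_simp

end NormingFunctional

/-! ### The average over the group. -/

namespace CStarAction

section Average

variable {G : Type u} [Group G] [TopologicalSpace G] {A : Type v} [NonUnitalCStarAlgebra A]
  (δ : CStarAction G A)

theorem act_mul_apply (g h : G) (a : A) : δ.act (g * h) a = δ.act g (δ.act h a) := by
  rw [map_mul]; rfl

theorem act_one_apply (a : A) : δ.act 1 a = a := by
  rw [map_one]; rfl

theorem act_inv_act (g : G) (a : A) : δ.act g⁻¹ (δ.act g a) = a := by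
  rw [← act_mul_apply, inv_mul_cancel, act_one_apply]

theorem act_act_inv (g : G) (a : A) : δ.act g (δ.act g⁻¹ a) = a := by
  rw [← act_mul_apply, mul_inv_cancel, act_one_apply]

theorem norm_act (g : G) (a : A) : ‖δ.act g a‖ = ‖a‖ := by
  refine le_antisymm (NonUnitalStarAlgHom.norm_apply_le (δ.act g) a) ?_
  conv_lhs => rw [← δ.act_inv_act g a]
  exact NonUnitalStarAlgHom.norm_apply_le (δ.act g⁻¹) _

/-- An automorphism of the action as a continuous linear map. -/
noncomputable def actL (g : G) : A →L[ℂ] A :=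
  LinearMap.mkContinuous { toFun := δ.act g, map_add' := map_add _, map_smul' := map_smul _ } 1
    fun a => by simp [norm_act]

@[simp] theorem actL_apply (g : G) (a : A) : δ.actL g a = δ.act g a := rfl

/-- The action is jointly continuous. -/
theorem continuous_act_comp {X : Type*} [TopologicalSpace X] {F : X → G} {f : X → A}
    (hF : Continuous F) (hf : Continuous f) :
    Continuous fun x => δ.act (F x) (f x) := by
  rw [continuous_iff_continuousAt]
  intro x
  have h1 : Filter.Tendsto (fun y => ‖f y - f x‖ + ‖δ.act (F y) (f x) - δ.act (F x) (f x)‖)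
      (nhds x) (nhds 0) := by
    have : Continuous fun y =>
        ‖f y - f x‖ + ‖δ.act (F y) (f x) - δ.act (F x) (f x)‖ := by
      have := (δ.continuous_act (f x)).comp hF
      fun_prop
    simpa using this.tendsto x
  rw [ContinuousAt, tendsto_iff_norm_sub_tendsto_zero]
  refine squeeze_zero (fun _ => norm_nonneg _) (fun y => ?_) h1
  have : δ.act (F y) (f y) - δ.act (F x) (f x)
      = δ.act (F y) (f y - f x) + (δ.act (F y) (f x) - δ.act (F x) (f x)) := by
    rw [map_sub]; abel
  rw [this]
  exact (norm_add_le _ _).trans (by rw [norm_act])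

variable [IsTopologicalGroup G] [CompactSpace G]

/-- The conditional expectation `a ↦ ∫ δ g a dg` onto the fixed point algebra. -/
noncomputable def average : A →L[ℂ] A :=
  LinearMap.mkContinuous
    { toFun := fun a => ∫ g, δ.act g a ∂(normalizedHaar G)
      map_add' := fun a b => by
        simp only [map_add]
        exact integral_add (integrable_normalizedHaar (δ.continuous_act a))
          (integrable_normalizedHaar (δ.continuous_act b))
      map_smul' := fun c a => by
        simp only [map_smul, RingHom.id_apply]
        exact integral_smul c _ }
    1 fun a => norm_integral_normalizedHaar_le fun g => by rw [norm_act, one_mul]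

theorem average_apply (a : A) : δ.average a = ∫ g, δ.act g a ∂(normalizedHaar G) := rfl

theorem norm_average_le (a : A) : ‖δ.average a‖ ≤ ‖a‖ :=
  norm_integral_normalizedHaar_le fun g => (δ.norm_act g a).le

theorem act_average (g : G) (a : A) : δ.act g (δ.average a) = δ.average a := by
  change δ.actL g (δ.average a) = _
  rw [average_apply, ← integral_normalizedHaar_clm _ (δ.continuous_act a)]
  simp_rw [actL_apply, ← act_mul_apply]
  exact integral_normalizedHaar_mul_left (fun h => δ.act h a) g

theorem average_mem_fixedAlgebra (a : A) : δ.average a ∈ δ.fixedAlgebra ⊤ :=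
  fun g _ => δ.act_average g a

/-- Averaging over the inverses gives the same conditional expectation. -/
theorem average_eq_integral_inv (a : A) :
    δ.average a = ∫ g, δ.act g⁻¹ a ∂(normalizedHaar G) := by
  have hc : ∀ b, Continuous fun g => δ.act g⁻¹ b := fun b =>
    (δ.continuous_act b).comp continuous_inv
  let E' : A →L[ℂ] A := LinearMap.mkContinuous
    { toFun := fun a => ∫ g, δ.act g⁻¹ a ∂(normalizedHaar G)
      map_add' := fun a b => by
        simp only [map_add]
        exact integral_add (integrable_normalizedHaar (hc a)) (integrable_normalizedHaar (hc b))
      map_smul' := fun c a => by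
        simp only [map_smul, RingHom.id_apply]
        exact integral_smul c _ }
    1 fun a => norm_integral_normalizedHaar_le fun g => by rw [norm_act, one_mul]
  -- `E'` absorbs the action on the inside and `average` on the outside, so `E' ∘ average` equals
  -- both `E'` and `average`.
  have h1 : ∀ h b, E' (δ.act h b) = E' b := fun h b => by
    change ∫ g, δ.act g⁻¹ (δ.act h b) ∂(normalizedHaar G) = ∫ g, δ.act g⁻¹ b ∂(normalizedHaar G)
    simp_rw [← act_mul_apply]
    rw [← integral_normalizedHaar_mul_left _ h]
    simp
  have h2 : E' (δ.average a) = δ.average a := by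
    change ∫ g, δ.act g⁻¹ (δ.average a) ∂(normalizedHaar G) = _
    simp_rw [act_average, integral_normalizedHaar_const]
  have h3 : E' (δ.average a) = E' a := by
    rw [average_apply, ← integral_normalizedHaar_clm _ (δ.continuous_act a)]
    simp_rw [h1, integral_normalizedHaar_const]
  exact h2.symm.trans h3

/-- This amounts to right invariance of Haar measure, obtained from left invariance by averaging
over inverses. -/
theorem average_act (h : G) (a : A) : δ.average (δ.act h a) = δ.average a := by
  rw [average_eq_integral_inv, average_eq_integral_inv]
  simp_rw [← act_mul_apply]
  rw [← integral_normalizedHaar_mul_left _ h]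
  simp

theorem average_nonneg [PartialOrder A] [StarOrderedRing A] {a : A} (ha : 0 ≤ a) :
    0 ≤ δ.average a :=
  integral_normalizedHaar_mem (convex_Ici 0) isClosed_Ici (δ.continuous_act a)
    fun g => map_nonneg (δ.act g) ha

/-- The fixed point algebra acts on the algebra without degeneracy. -/
theorem exists_norm_average_mul_sub_le (x : A) {ε : ℝ} (hε : 0 < ε) :
    ∃ e : A, ‖δ.average e * x - x‖ ≤ ε := by
  let _ : PartialOrder A := CStarAlgebra.spectralOrder A
  have _ : StarOrderedRing A := CStarAlgebra.spectralOrderedRing A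
  have hc : Continuous fun g => δ.act g⁻¹ x := (δ.continuous_act x).comp continuous_inv
  -- The orbit of `x` is compact, so one `e` from the approximate unit serves all of it; this
  -- suffices because `δ g e * x - x` is the image under `δ g` of `e * k - k` with `k = δ g⁻¹ x`.
  obtain ⟨t, -, ht, hcov⟩ := (isCompact_range hc).finite_cover_balls (e := ε / 3) (by positivity)
  have hu := CStarAlgebra.increasingApproximateUnit A
  have hev : ∀ᶠ e in CStarAlgebra.approximateUnit A, ‖e‖ ≤ 1 ∧ ∀ y ∈ t, ‖e * y - y‖ < ε / 3 := by
    refine hu.eventually_norm.and ((Filter.eventually_all_finite ht).2 fun y _ => ?_)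
    have := tendsto_iff_norm_sub_tendsto_zero.1 (hu.tendsto_mul_right y)
    exact this.eventually_lt_const (by positivity)
  obtain ⟨e, he, hey⟩ := hev.exists
  have key : ∀ g, ‖e * δ.act g⁻¹ x - δ.act g⁻¹ x‖ ≤ ε := by
    intro g
    obtain ⟨y, hy, hgy⟩ := Set.mem_iUnion₂.1 (hcov ⟨g, rfl⟩)
    set k := δ.act g⁻¹ x
    rw [Metric.mem_ball, dist_eq_norm] at hgy
    have h1 : e * k - k = e * (k - y) + (e * y - y) - (k - y) := by rw [mul_sub]; abel
    have h2 : ‖e * (k - y)‖ ≤ ε / 3 := (norm_mul_le _ _).trans <|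
      (mul_le_of_le_one_left (norm_nonneg _) he).trans hgy.le
    rw [h1]
    calc _ ≤ ‖e * (k - y)‖ + ‖e * y - y‖ + ‖k - y‖ :=
          (norm_sub_le _ _).trans (by gcongr; exact norm_add_le _ _)
      _ ≤ ε := by linarith [hey y hy]
  refine ⟨e, ?_⟩
  have h1 : δ.average e * x - x = ∫ g, (δ.act g e * x - x) ∂(normalizedHaar G) := by
    let _ : MeasurableSpace G := borel G
    have hce := δ.continuous_act e
    rw [integral_sub, integral_normalizedHaar_const]
    · congr 1
      exact (integral_normalizedHaar_clm ((ContinuousLinearMap.mul ℂ A).flip x) hce).symm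
    all_goals exact integrable_normalizedHaar (by fun_prop)
  rw [h1]
  refine norm_integral_normalizedHaar_le fun g => ?_
  have : δ.act g e * x - x = δ.act g (e * δ.act g⁻¹ x - δ.act g⁻¹ x) := by
    rw [map_sub, map_mul, act_act_inv]
  rw [this, norm_act]
  exact key g

end Average

end CStarAction

/-! ### Covariant representations from invariant positive functionals. -/

/-- The identification of a Hilbert space with a copy of it in a larger universe. -/
noncomputable def hilbertLift (K : Type v) [NormedAddCommGroup K] [InnerProductSpace ℂ K] :
    PiLp 2 (fun _ : PUnit.{max u v + 1} => K) ≃ₗᵢ[ℂ] K where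
  toLinearEquiv := (PiLp.equivOfUnique 2 ℂ (fun _ : PUnit.{max u v + 1} => K)).toLinearEquiv
  norm_map' := fun x => by
    rw [PiLp.norm_eq_of_L2]
    simp

namespace CStarAction

section Lift

variable {G : Type u} [Group G] [TopologicalSpace G] {C : Type v} [NonUnitalCStarAlgebra C]

/-- The covariant representation given by a representation on a unitarily equivalent space. -/
noncomputable def CovariantRep.ofHilbert (β : CStarAction G C) {K : Type v}
    [NormedAddCommGroup K] [InnerProductSpace ℂ K] [CompleteSpace K] {L : Type (max u v)}
    [NormedAddCommGroup L] [InnerProductSpace ℂ L] [CompleteSpace L] (e : L ≃ₗᵢ[ℂ] K)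
    (π : C →⋆ₙₐ[ℂ] (K →L[ℂ] K)) (U : G →* unitary (K →L[ℂ] K))
    (hU : ∀ ξ : K, Continuous fun g : G => (U g : K →L[ℂ] K) ξ)
    (hπU : ∀ (g : G) (c : C), (U g : K →L[ℂ] K) * π c * star (U g : K →L[ℂ] K) = π (β.act g c)) :
    CovariantRep β where
  H := L
  π :=
    { toFun := fun c => e.symm.conjStarAlgEquiv (π c)
      map_smul' := fun r c => by rw [map_smul, map_smul]; rfl
      map_zero' := by rw [map_zero, map_zero]
      map_add' := fun c d => by rw [map_add, map_add]
      map_mul' := fun c d => by rw [map_mul, map_mul]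
      map_star' := fun c => by rw [map_star, map_star] }
  U :=
    { toFun := fun g => ⟨e.symm.conjStarAlgEquiv (U g : K →L[ℂ] K),
        Unitary.map_mem _ (U g).2⟩
      map_one' := Subtype.ext <| by rw [map_one]; exact map_one _
      map_mul' := fun g h => Subtype.ext <| by rw [map_mul]; exact map_mul _ _ _ }
  continuous_U := fun ξ => e.symm.continuous.comp
    (hU (e ξ))
  covariant := fun g c => by
    change e.symm.conjStarAlgEquiv (U g : K →L[ℂ] K) *
      e.symm.conjStarAlgEquiv (π c) *
      star (e.symm.conjStarAlgEquiv (U g : K →L[ℂ] K)) =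
      e.symm.conjStarAlgEquiv (π (β.act g c))
    rw [← map_star, ← map_mul, ← map_mul, hπU]

end Lift

section GNS

open scoped ComplexOrder

variable {G : Type u} [Group G] [TopologicalSpace G]
  {A : Type v} [NonUnitalCStarAlgebra A] [PartialOrder A] [StarOrderedRing A]
  (δ : CStarAction G A) (ω : A →ₚ[ℂ] ℂ) (hω : ∀ g a, ω (δ.act g a) = ω a)

/-- The isometry of the GNS pre-Hilbert space of an invariant functional given by the action. -/
noncomputable def preGNSAct (g : G) : ω.PreGNS →L[ℂ] ω.PreGNS :=
  LinearMap.mkContinuous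
    (ω.toPreGNS.toLinearMap ∘ₗ (δ.actL g : A →ₗ[ℂ] A) ∘ₗ ω.ofPreGNS.toLinearMap) 1 fun x => by
      rw [PositiveLinearMap.preGNS_norm_def, PositiveLinearMap.preGNS_norm_def, one_mul]
      have : star (δ.act g (ω.ofPreGNS x)) * δ.act g (ω.ofPreGNS x)
          = δ.act g (star (ω.ofPreGNS x) * ω.ofPreGNS x) := by rw [map_mul, map_star]
      change √(ω (star (δ.act g (ω.ofPreGNS x)) * δ.act g (ω.ofPreGNS x))).re ≤ _
      rw [this, hω]

theorem preGNSAct_toPreGNS (g : G) (a : A) :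
    δ.preGNSAct ω hω g (ω.toPreGNS a) = ω.toPreGNS (δ.act g a) := rfl

/-- The GNS vector of an algebra element. -/
noncomputable def gnsVector (a : A) : ω.GNS := ((ω.toPreGNS a : ω.PreGNS) : ω.GNS)

theorem norm_gnsVector_sq (a : A) : ‖gnsVector ω a‖ ^ 2 = (ω (star a * a)).re := by
  have h := ω.preGNS_norm_sq (ω.toPreGNS a)
  rw [gnsVector, UniformSpace.Completion.norm_coe]
  have := congrArg Complex.re h
  simpa [← Complex.ofReal_pow] using this

theorem gns_induction {p : ω.GNS → Prop} (hp : IsClosed {ξ | p ξ}) (h : ∀ a, p (gnsVector ω a))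
    (ξ : ω.GNS) : p ξ :=
  UniformSpace.Completion.induction_on ξ hp h

theorem inner_gnsVector (a b : A) :
    inner ℂ (gnsVector ω a) (gnsVector ω b) = ω (star a * b) := by
  rw [gnsVector, gnsVector, UniformSpace.Completion.inner_coe]
  rfl

/-- The GNS operator of the action. -/
noncomputable def gnsAct (g : G) : ω.GNS →L[ℂ] ω.GNS := (δ.preGNSAct ω hω g).completion

theorem gnsAct_gnsVector (g : G) (a : A) :
    δ.gnsAct ω hω g (gnsVector ω a) = gnsVector ω (δ.act g a) := by
  simp [gnsAct, gnsVector, preGNSAct_toPreGNS]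

theorem gns_clm_ext {S T : ω.GNS →L[ℂ] ω.GNS} (h : ∀ a, S (gnsVector ω a) = T (gnsVector ω a)) :
    S = T := by
  ext ξ
  induction ξ using gns_induction with
  | hp => exact isClosed_eq S.continuous T.continuous
  | h a => exact h a

theorem gnsAct_mul (g h : G) :
    δ.gnsAct ω hω (g * h) = δ.gnsAct ω hω g * δ.gnsAct ω hω h :=
  gns_clm_ext ω fun a => by
    simp [gnsAct_gnsVector]

theorem gnsAct_one : δ.gnsAct ω hω 1 = 1 :=
  gns_clm_ext ω fun a => by simp [gnsAct_gnsVector]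

theorem star_gnsAct (g : G) : star (δ.gnsAct ω hω g) = δ.gnsAct ω hω g⁻¹ := by
  symm
  refine (ContinuousLinearMap.eq_adjoint_iff _ _).2 fun ξ η => ?_
  induction ξ using gns_induction with
  | hp => exact isClosed_eq (by fun_prop) (by fun_prop)
  | h a =>
    induction η using gns_induction with
    | hp => exact isClosed_eq (by fun_prop) (by fun_prop)
    | h b =>
      rw [gnsAct_gnsVector, gnsAct_gnsVector, inner_gnsVector, inner_gnsVector, ← hω g, map_mul,
        map_star, act_act_inv]

/-- The unitary representation on the GNS space of an invariant functional. -/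
noncomputable def gnsUnitary : G →* unitary (ω.GNS →L[ℂ] ω.GNS) where
  toFun g := ⟨δ.gnsAct ω hω g, by
    rw [Unitary.mem_iff, star_gnsAct, ← gnsAct_mul, ← gnsAct_mul, inv_mul_cancel, mul_inv_cancel,
      gnsAct_one]
    exact ⟨rfl, rfl⟩⟩
  map_one' := Subtype.ext (δ.gnsAct_one ω hω)
  map_mul' g h := Subtype.ext (δ.gnsAct_mul ω hω g h)

theorem coe_gnsUnitary (g : G) :
    (δ.gnsUnitary ω hω g : ω.GNS →L[ℂ] ω.GNS) = δ.gnsAct ω hω g := rfl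

variable (hω1 : ∀ a, 0 ≤ a → (ω a).re ≤ ‖a‖)

include hω1 in
theorem norm_gnsVector_le (a : A) : ‖gnsVector ω a‖ ≤ ‖a‖ := by
  rw [← sq_le_sq₀ (norm_nonneg _) (norm_nonneg _), norm_gnsVector_sq, sq,
    ← CStarRing.norm_star_mul_self]
  exact hω1 _ (star_mul_self_nonneg a)

/-- The map into the GNS space as a continuous linear map. -/
noncomputable def gnsVectorL : A →L[ℂ] ω.GNS :=
  LinearMap.mkContinuous
    { toFun := gnsVector ω
      map_add' := fun a b => by
        rw [gnsVector, map_add]; exact UniformSpace.Completion.coe_add _ _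
      map_smul' := fun c a => by simp [gnsVector] } 1
    fun a => by rw [one_mul]; exact norm_gnsVector_le ω hω1 a

theorem norm_gnsAct (g : G) (ξ : ω.GNS) : ‖δ.gnsAct ω hω g ξ‖ = ‖ξ‖ :=
  ContinuousLinearMap.norm_map_of_mem_unitary (δ.gnsUnitary ω hω g).2 ξ

-- Orbits of GNS vectors are continuous, and since the operators are isometric the orbit of any `ξ`
-- is a uniform limit of such orbits.
include hω1 in
theorem continuous_gnsAct (ξ : ω.GNS) : Continuous fun g => δ.gnsAct ω hω g ξ := by
  refine continuous_of_uniform_approx_of_continuous fun s hs => ?_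
  obtain ⟨ε, hε, hs⟩ := Metric.mem_uniformity_dist.1 hs
  obtain ⟨x, hx⟩ := UniformSpace.Completion.denseRange_coe.exists_dist_lt ξ hε
  refine ⟨fun g => δ.gnsAct ω hω g (gnsVector ω (ω.ofPreGNS x)), ?_, fun g => hs ?_⟩
  · simp_rw [gnsAct_gnsVector]
    exact (gnsVectorL ω hω1).continuous.comp (δ.continuous_act _)
  · rw [dist_eq_norm, ← map_sub, norm_gnsAct, ← dist_eq_norm]
    exact hx

theorem gns_apply_gnsVector (a b : A) :
    ω.gnsNonUnitalStarAlgHom a (gnsVector ω b) = gnsVector ω (a * b) := by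
  simp [gnsVector]

end GNS

/-- A bounded map from `A` to the space of a covariant representation of a system `(C, G, β)` that
turns the action of `G` on `A` and the left multiplications by the image of `C` into the covariant
representation. -/
structure Intertwines {G : Type u} [Group G] [TopologicalSpace G] {A C : Type v}
    [NonUnitalCStarAlgebra A] [NonUnitalCStarAlgebra C] (δ : CStarAction G A)
    {β : CStarAction G C} (ι : C →⋆ₙₐ[ℂ] A) (ρ : CovariantRep β) (j : A →L[ℂ] ρ.H) : Prop where
  π_apply : ∀ c x, ρ.π c (j x) = j (ι c * x)
  U_apply : ∀ g x, (ρ.U g : ρ.H →L[ℂ] ρ.H) (j x) = j (δ.act g x)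
  norm_le : ∀ x, ‖j x‖ ≤ ‖x‖

section Existence

open scoped ComplexOrder

variable {G : Type u} [Group G] [TopologicalSpace G] [IsTopologicalGroup G] [CompactSpace G]
  {A C : Type v} [NonUnitalCStarAlgebra A] [PartialOrder A] [StarOrderedRing A]
  [NonUnitalCStarAlgebra C]

/-- This is the GNS representation of `τ ∘ average`: invariance makes the action unitary, and `C`
acts through `ι` by left multiplication. The norm formula is what later recovers estimates in `A`.
-/
theorem exists_intertwines (δ : CStarAction G A) (β : CStarAction G C) (ι : C →⋆ₙₐ[ℂ] A)
    (hι : ∀ g c, ι (β.act g c) = δ.act g (ι c)) (τ : A →ₚ[ℂ] ℂ)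
    (hτ : ∀ a, 0 ≤ a → (τ a).re ≤ ‖a‖) :
    ∃ (ρ : CovariantRep β) (j : A →L[ℂ] ρ.H), Intertwines δ ι ρ j ∧
      ∀ x, ‖j x‖ ^ 2 = (τ (δ.average (star x * x))).re := by
  let ω : A →ₚ[ℂ] ℂ := PositiveLinearMap.mk₀ (τ.toLinearMap ∘ₗ (δ.average : A →ₗ[ℂ] A))
    fun a ha => τ.map_nonneg (δ.average_nonneg ha)
  have hω_apply : ∀ a, ω a = τ (δ.average a) := fun a => rfl
  have hω : ∀ g a, ω (δ.act g a) = ω a := fun g a => by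
    rw [hω_apply, hω_apply, average_act]
  have hω1 : ∀ a, 0 ≤ a → (ω a).re ≤ ‖a‖ := fun a ha =>
    (hτ _ (δ.average_nonneg ha)).trans (δ.norm_average_le a)
  -- The GNS space lives in the universe of `A`, whereas a covariant representation requires the
  -- larger one, hence the lift.
  let ρ : CovariantRep β := CovariantRep.ofHilbert β (hilbertLift.{u, v} ω.GNS)
    (ω.gnsNonUnitalStarAlgHom.comp ι)
    (δ.gnsUnitary ω hω) (δ.continuous_gnsAct ω hω hω1) fun g c => by
      rw [coe_gnsUnitary, star_gnsAct]
      refine gns_clm_ext ω fun a => ?_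
      change δ.gnsAct ω hω g (ω.gnsNonUnitalStarAlgHom (ι c) (δ.gnsAct ω hω g⁻¹ (gnsVector ω a))) =
        ω.gnsNonUnitalStarAlgHom (ι (β.act g c)) (gnsVector ω a)
      rw [gnsAct_gnsVector, gns_apply_gnsVector, gnsAct_gnsVector, gns_apply_gnsVector, map_mul,
        act_act_inv, hι]
  let e : ρ.H ≃ₗᵢ[ℂ] ω.GNS := hilbertLift.{u, v} ω.GNS
  have hπ : ∀ c ξ, ρ.π c (e.symm ξ) = e.symm (ω.gnsNonUnitalStarAlgHom (ι c) ξ) := fun c ξ =>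
    congrArg (fun η => e.symm (ω.gnsNonUnitalStarAlgHom (ι c) η)) (e.apply_symm_apply ξ)
  have hU : ∀ g ξ, (ρ.U g : ρ.H →L[ℂ] ρ.H) (e.symm ξ) = e.symm (δ.gnsAct ω hω g ξ) := fun g ξ =>
    congrArg (fun η => e.symm (δ.gnsAct ω hω g η)) (e.apply_symm_apply ξ)
  let j : A →L[ℂ] ρ.H := (e.symm.toContinuousLinearEquiv : ω.GNS →L[ℂ] ρ.H) ∘L gnsVectorL ω hω1
  have hj : ∀ x, j x = e.symm (gnsVector ω x) := fun x => rfl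
  refine ⟨ρ, j, ⟨fun c x => ?_, fun g x => ?_, fun x => ?_⟩, fun x => ?_⟩
  · rw [hj, hj, hπ, gns_apply_gnsVector]
  · rw [hj, hj, hU, gnsAct_gnsVector]
  · rw [hj, e.symm.norm_map]
    exact norm_gnsVector_le ω hω1 x
  · rw [hj, e.symm.norm_map, norm_gnsVector_sq, hω_apply]

end Existence

end CStarAction

/-! ### The crossed product acting on vectors that come from `A`. -/

namespace CStarAction

section Evaluation

variable {G : Type u} [Group G] [TopologicalSpace G] {C : Type v} [NonUnitalCStarAlgebra C]
  {β : CStarAction G C}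

/-- The component of a family of operators in a covariant representation. -/
def UniversalOperators.eval (X : UniversalOperators β) (ρ : CovariantRep β) : ρ.H →L[ℂ] ρ.H :=
  X.1 ρ

namespace UniversalOperators

theorem eval_zero (ρ : CovariantRep β) : (0 : UniversalOperators β).eval ρ = 0 := rfl

theorem eval_add (X Y : UniversalOperators β) (ρ : CovariantRep β) :
    (X + Y).eval ρ = X.eval ρ + Y.eval ρ := rfl

theorem eval_sub (X Y : UniversalOperators β) (ρ : CovariantRep β) :
    (X - Y).eval ρ = X.eval ρ - Y.eval ρ := rfl

theorem eval_smul (r : ℂ) (X : UniversalOperators β) (ρ : CovariantRep β) :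
    (r • X).eval ρ = r • X.eval ρ := rfl

theorem eval_mul (X Y : UniversalOperators β) (ρ : CovariantRep β) :
    (X * Y).eval ρ = X.eval ρ * Y.eval ρ := rfl

theorem norm_eval_le (X : UniversalOperators β) (ρ : CovariantRep β) : ‖X.eval ρ‖ ≤ ‖X‖ :=
  lp.norm_apply_le_norm (E := fun ρ : CovariantRep β => ρ.H →L[ℂ] ρ.H) ENNReal.top_ne_zero X ρ

end UniversalOperators

end Evaluation

section Maps

variable {G : Type u} [Group G] [TopologicalSpace G] {A C : Type v} [NonUnitalCStarAlgebra A]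
  [NonUnitalCStarAlgebra C] (δ : CStarAction G A) {β : CStarAction G C} (ι : C →⋆ₙₐ[ℂ] A)

/-- `X` maps the vectors coming from `V` to vectors that are approximated by those coming from `W`,
uniformly in the covariant representation. -/
def MapsApprox (V W : Submodule ℂ A) (X : UniversalOperators β) : Prop :=
  ∀ x ∈ V, ∀ ε : ℝ, 0 < ε → ∃ y ∈ W, ∀ (ρ : CovariantRep β) (j : A →L[ℂ] ρ.H),
    Intertwines δ ι ρ j → ‖X.eval ρ (j x) - j y‖ ≤ ε

namespace MapsApprox

variable {δ ι} {V W Z : Submodule ℂ A} {X Y : UniversalOperators β}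

theorem of_exact (f : A → A) (hf : ∀ x ∈ V, f x ∈ W)
    (h : ∀ (ρ : CovariantRep β) (j : A →L[ℂ] ρ.H), Intertwines δ ι ρ j →
      ∀ x, X.eval ρ (j x) = j (f x)) : MapsApprox δ ι V W X :=
  fun x hx ε hε => ⟨f x, hf x hx, fun ρ j hj => by rw [h ρ j hj, sub_self, norm_zero]; exact hε.le⟩

theorem zero : MapsApprox δ ι V W (0 : UniversalOperators β) :=
  of_exact (fun _ => 0) (fun _ _ => W.zero_mem) fun ρ j _ x => by
    rw [UniversalOperators.eval_zero, map_zero]; rfl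

theorem add (hX : MapsApprox δ ι V W X) (hY : MapsApprox δ ι V W Y) :
    MapsApprox δ ι V W (X + Y) := by
  intro x hx ε hε
  obtain ⟨y, hy, h⟩ := hX x hx (ε / 2) (half_pos hε)
  obtain ⟨z, hz, h'⟩ := hY x hx (ε / 2) (half_pos hε)
  refine ⟨y + z, W.add_mem hy hz, fun ρ j hj => ?_⟩
  have : (X + Y).eval ρ (j x) - j (y + z)
      = (X.eval ρ (j x) - j y) + (Y.eval ρ (j x) - j z) := by
    rw [UniversalOperators.eval_add, map_add, add_apply]; abel
  rw [this]
  exact (norm_add_le _ _).trans (by linarith [h ρ j hj, h' ρ j hj])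

theorem mul (hX : MapsApprox δ ι W Z X) (hY : MapsApprox δ ι V W Y) :
    MapsApprox δ ι V Z (X * Y) := by
  intro x hx ε hε
  have hX0 : 0 < ‖X‖ + 1 := by positivity
  obtain ⟨y, hy, h⟩ := hY x hx (ε / 2 / (‖X‖ + 1)) (by positivity)
  obtain ⟨z, hz, h'⟩ := hX y hy (ε / 2) (half_pos hε)
  refine ⟨z, hz, fun ρ j hj => ?_⟩
  have e : (X * Y).eval ρ (j x) - j z
      = X.eval ρ (Y.eval ρ (j x) - j y) + (X.eval ρ (j y) - j z) := by
    rw [UniversalOperators.eval_mul, map_sub, mul_apply_eq_comp]; abel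
  have h1 : ‖X.eval ρ (Y.eval ρ (j x) - j y)‖ ≤ ε / 2 := by
    refine ((X.eval ρ).le_opNorm _).trans ?_
    calc _ ≤ (‖X‖ + 1) * (ε / 2 / (‖X‖ + 1)) := by
          gcongr
          · exact (X.norm_eval_le ρ).trans (by linarith)
          · exact h ρ j hj
      _ = ε / 2 := by field_simp
  rw [e]
  exact (norm_add_le _ _).trans (by linarith [h' ρ j hj])

theorem smul (r : ℂ) (hX : MapsApprox δ ι V W X) : MapsApprox δ ι V W (r • X) := by
  intro x hx ε hε
  have hr0 : 0 < ‖r‖ + 1 := by positivity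
  obtain ⟨y, hy, h⟩ := hX x hx (ε / (‖r‖ + 1)) (by positivity)
  refine ⟨r • y, W.smul_mem r hy, fun ρ j hj => ?_⟩
  rw [UniversalOperators.eval_smul, map_smul, smul_apply, ← smul_sub, norm_smul]
  calc _ ≤ (‖r‖ + 1) * (ε / (‖r‖ + 1)) := by
        gcongr
        · linarith
        · exact h ρ j hj
    _ = ε := by field_simp

/-- The bounds `‖X.eval ρ‖ ≤ ‖X‖` and `‖j x‖ ≤ ‖x‖` do not depend on `ρ` and `j`, so one approximant
still works for all of them in the limit. -/
theorem isClosed : IsClosed {X : UniversalOperators β | MapsApprox δ ι V W X} := by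
  refine isClosed_of_closure_subset fun X hX x hx ε hε => ?_
  obtain ⟨Y, hY, hXY⟩ := Metric.mem_closure_iff.1 hX (ε / 2 / (‖x‖ + 1)) (by positivity)
  obtain ⟨y, hy, h⟩ := hY x hx (ε / 2) (half_pos hε)
  refine ⟨y, hy, fun ρ j hj => ?_⟩
  have e : X.eval ρ (j x) - j y = (X - Y).eval ρ (j x) + (Y.eval ρ (j x) - j y) := by
    rw [UniversalOperators.eval_sub, sub_apply]; abel
  have h1 : ‖(X - Y).eval ρ (j x)‖ ≤ ε / 2 := by
    refine (((X - Y).eval ρ).le_opNorm _).trans ?_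
    calc _ ≤ (ε / 2 / (‖x‖ + 1)) * (‖x‖ + 1) := by
          gcongr
          · refine ((X - Y).norm_eval_le ρ).trans ?_
            rw [← dist_eq_norm]
            exact hXY.le
          · exact (hj.norm_le x).trans (by linarith)
      _ = ε / 2 := by field_simp
  rw [e]
  exact (norm_add_le _ _).trans (by linarith [h ρ j hj])

end MapsApprox

end Maps

section Continuity

variable {G : Type u} [Group G] [TopologicalSpace G] {A C : Type v} [NonUnitalCStarAlgebra A]
  [NonUnitalCStarAlgebra C]

theorem continuous_starHom (ι : C →⋆ₙₐ[ℂ] A) : Continuous ι :=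
  AddMonoidHomClass.continuous_of_bound ι 1 fun a => by
    simpa using NonUnitalStarAlgHom.norm_apply_le ι a

theorem continuous_mul_act (δ : CStarAction G A) (ι : C →⋆ₙₐ[ℂ] A) (f : C(G, C)) (x : A) :
    Continuous fun g => ι (f g) * δ.act g x :=
  ((continuous_starHom ι).comp f.continuous).mul (δ.continuous_act x)

theorem continuous_act_inv_mul [IsTopologicalGroup G] (δ : CStarAction G A) (ι : C →⋆ₙₐ[ℂ] A)
    (f : C(G, C)) (x : A) : Continuous fun g => δ.act g⁻¹ (ι (star (f g)) * x) :=
  δ.continuous_act_comp continuous_inv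
    (((continuous_starHom ι).comp f.continuous.star).mul continuous_const)

end Continuity

section Crossed

variable {G : Type u} [Group G] [TopologicalSpace G] [IsTopologicalGroup G] [CompactSpace G]
  {A C : Type v} [NonUnitalCStarAlgebra A] [NonUnitalCStarAlgebra C] {δ : CStarAction G A}
  {β : CStarAction G C} {ι : C →⋆ₙₐ[ℂ] A}

namespace Intertwines

variable {ρ : CovariantRep β} {j : A →L[ℂ] ρ.H} (hj : Intertwines δ ι ρ j)
include hj

theorem integratedForm_apply (f : C(G, C)) (x : A) :
    ρ.integratedForm f (j x) = j (∫ g, ι (f g) * δ.act g x ∂(normalizedHaar G)) := by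
  rw [CovariantRep.integratedForm_apply,
    ← integral_normalizedHaar_clm j (continuous_mul_act δ ι f x)]
  simp_rw [hj.U_apply, hj.π_apply]

/-- The adjoint is computed under the integral. It is needed because the crossed product is
generated as a star algebra. -/
theorem star_integratedForm_apply (f : C(G, C)) (x : A) :
    star (ρ.integratedForm f) (j x) =
      j (∫ g, δ.act g⁻¹ (ι (star (f g)) * x) ∂(normalizedHaar G)) := by
  have hc := continuous_act_inv_mul δ ι f x
  have hcj : Continuous fun g => j (δ.act g⁻¹ (ι (star (f g)) * x)) := j.continuous.comp hc
  refine ext_inner_right ℂ fun ξ => ?_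
  rw [ContinuousLinearMap.star_eq_adjoint, ContinuousLinearMap.adjoint_inner_left,
    CovariantRep.integratedForm_apply, ← integral_normalizedHaar_clm j hc]
  let _ : MeasurableSpace G := borel G
  rw [← integral_inner (integrable_normalizedHaar (ρ.continuous_integrand f ξ)),
    ← inner_conj_symm, ← integral_inner (integrable_normalizedHaar hcj), ← integral_conj]
  congr 1
  ext g
  rw [inner_conj_symm, ← hj.U_apply, ← hj.π_apply, map_star, map_inv,
    ← ContinuousLinearMap.adjoint_inner_left, ← ContinuousLinearMap.adjoint_inner_left]
  rfl

theorem groupOperator_one_apply (x : A) : ρ.groupOperator 1 (j x) = j (δ.average x) := by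
  rw [CovariantRep.groupOperator_apply, average_apply,
    ← integral_normalizedHaar_clm j (δ.continuous_act x)]
  simp_rw [hj.U_apply, ContinuousMap.one_apply, one_smul]

end Intertwines

theorem mapsApprox_of_mem_crossedProduct {V : Submodule ℂ A} (hVc : IsClosed (V : Set A))
    (hVδ : ∀ g, ∀ x ∈ V, δ.act g x ∈ V) (hVι : ∀ c, ∀ x ∈ V, ι c * x ∈ V)
    {X : UniversalOperators β} (hX : X ∈ β.crossedProduct) : MapsApprox δ ι V V X := by
  have hconv : Convex ℝ (V : Set A) := (V.restrictScalars ℝ).convex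
  -- Approximate invariance of `V` does not pass to adjoints by itself, so the induction carries `Y`
  -- and `star Y` together.
  suffices h : X ∈ {Y : UniversalOperators β | MapsApprox δ ι V V Y} ∩
      {Y | MapsApprox δ ι V V (star Y)} from h.1
  refine closure_minimal (fun Y hY => ?_) (MapsApprox.isClosed.inter
    (MapsApprox.isClosed.preimage continuous_star)) hX
  refine NonUnitalStarAlgebra.adjoin_induction (p := fun Y _ => MapsApprox δ ι V V Y ∧
    MapsApprox δ ι V V (star Y)) (mem := ?_) (add := ?_) (zero := ?_) (mul := ?_) (smul := ?_)
    (star := ?_) (ha := hY)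
  · rintro _ ⟨f, rfl⟩
    constructor
    · exact MapsApprox.of_exact _ (fun x hx => integral_normalizedHaar_mem hconv hVc
        (continuous_mul_act δ ι f x) fun g => hVι _ _ (hVδ g x hx))
        fun ρ j hj x => hj.integratedForm_apply f x
    · exact MapsApprox.of_exact _ (fun x hx => integral_normalizedHaar_mem hconv hVc
        (continuous_act_inv_mul δ ι f x) fun g => hVδ _ _ (hVι _ x hx))
        fun ρ j hj x => hj.star_integratedForm_apply f x
  · rintro Y Z - - ⟨h1, h2⟩ ⟨h3, h4⟩
    exact ⟨h1.add h3, by rw [star_add]; exact h2.add h4⟩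
  · exact ⟨.zero, by rw [star_zero]; exact .zero⟩
  · rintro Y Z - - ⟨h1, h2⟩ ⟨h3, h4⟩
    exact ⟨h1.mul h3, by rw [star_mul]; exact h4.mul h2⟩
  · rintro r Y - ⟨h1, h2⟩
    exact ⟨h1.smul r, by rw [star_smul]; exact h2.smul _⟩
  · rintro Y - ⟨h1, h2⟩
    exact ⟨h2, by rwa [star_star]⟩

/-- In a generator `P * χ * Q`, the factor `Q` keeps vectors in the image of `A`, `χ` averages them
into `W`, and `P` preserves `W`. -/
theorem mapsApprox_of_mem_trivialCharacterIdeal {W : Submodule ℂ A} (hWc : IsClosed (W : Set A))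
    (hWδ : ∀ g, ∀ x ∈ W, δ.act g x ∈ W) (hWι : ∀ c, ∀ x ∈ W, ι c * x ∈ W)
    (hW : ∀ x, δ.average x ∈ W) {X : UniversalOperators β} (hX : X ∈ β.trivialCharacterIdeal) :
    MapsApprox δ ι ⊤ W X := by
  refine closure_minimal (fun Y hY => ?_)
    (MapsApprox.isClosed (δ := δ) (ι := ι) (V := ⊤) (W := W)) hX
  refine Submodule.span_induction (p := fun Y _ => MapsApprox δ ι ⊤ W Y) ?_ .zero
    (fun _ _ _ _ h h' => h.add h') (fun r _ _ h => h.smul r) hY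
  rintro _ ⟨P, hP, Q, hQ, rfl⟩
  have hχ : MapsApprox δ ι ⊤ W (β.groupMultiplier 1) :=
    MapsApprox.of_exact _ (fun x _ => hW x) fun ρ j hj x => hj.groupOperator_one_apply x
  exact ((mapsApprox_of_mem_crossedProduct hWc hWδ hWι hP).mul hχ).mul
    (mapsApprox_of_mem_crossedProduct (V := ⊤) isClosed_univ (fun _ _ _ => trivial)
      (fun _ _ _ => trivial) hQ)

end Crossed

/-! ### From Hilbert space estimates back to the norm of `A`. -/

section Approximation

open scoped ComplexOrder

variable {G : Type u} [Group G] [TopologicalSpace G] [IsTopologicalGroup G] [CompactSpace G]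
  {A C : Type v} [NonUnitalCStarAlgebra A] [NonUnitalCStarAlgebra C] {δ : CStarAction G A}
  {β : CStarAction G C} {ι : C →⋆ₙₐ[ℂ] A}

/-- Take `τ` norming `star T * T`. Cauchy–Schwarz in the GNS space of `τ` bounds `‖T‖ ^ 2` by `‖ψ‖ ^
2` times the integral of `τ (δ g (star z * z))`, and that integral is `‖j z‖ ^ 2` for the
representation of the averaged functional. -/
theorem norm_integral_smul_act_le (hι : ∀ g c, ι (β.act g c) = δ.act g (ι c)) (ψ : C(G, ℂ)) {z : A}
    {ε : ℝ} (hε : 0 ≤ ε)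
    (hz : ∀ (ρ : CovariantRep β) (j : A →L[ℂ] ρ.H), Intertwines δ ι ρ j → ‖j z‖ ≤ ε) :
    ‖∫ g, ψ g • δ.act g z ∂(normalizedHaar G)‖ ≤ ‖ψ‖ * ε := by
  let _ : PartialOrder A := CStarAlgebra.spectralOrder A
  have _ : StarOrderedRing A := CStarAlgebra.spectralOrderedRing A
  have hcz := δ.continuous_act z
  have hcT : Continuous fun g => ψ g • δ.act g z := ψ.continuous.smul hcz
  set T := ∫ g, ψ g • δ.act g z ∂(normalizedHaar G) with hT
  obtain ⟨τ, hτ, hτT⟩ := exists_positiveLinearMap_apply_eq_norm (star T * T)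
    (star_mul_self_nonneg T)
  obtain ⟨ρ, j, hj, hjn⟩ := exists_intertwines δ β ι hι τ hτ
  let v := gnsVectorL τ hτ
  have hv : ∀ a, ‖v a‖ ^ 2 = (τ (star a * a)).re := fun a => norm_gnsVector_sq τ a
  have hcv : Continuous fun g => v (δ.act g z) := v.continuous.comp hcz
  have h1 : ‖T‖ ^ 2 = ‖∫ g, ψ g • v (δ.act g z) ∂(normalizedHaar G)‖ ^ 2 := by
    have : ∫ g, ψ g • v (δ.act g z) ∂(normalizedHaar G) = v T := by
      rw [hT, ← integral_normalizedHaar_clm v hcT]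
      simp_rw [map_smul]
    rw [this, hv, hτT, CStarRing.norm_star_mul_self, sq]
  have h2 : ∫ g, ‖v (δ.act g z)‖ ^ 2 ∂(normalizedHaar G) = ‖j z‖ ^ 2 := by
    let τL : A →L[ℝ] ℝ := Complex.reCLM ∘L
      (⟨τ.toLinearMap, map_continuous τ⟩ : A →L[ℂ] ℂ).restrictScalars ℝ
    have hτL : ∀ a, τL a = (τ a).re := fun a => rfl
    rw [hjn, average_apply, ← hτL, ← integral_normalizedHaar_clm τL (δ.continuous_act _)]
    simp_rw [hv, hτL, map_mul, map_star]
  have h3 : ‖T‖ ^ 2 ≤ (‖ψ‖ * ε) ^ 2 := by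
    rw [h1]
    refine (sq_norm_integral_normalizedHaar_le (by fun_prop)).trans ?_
    calc _ ≤ ∫ g, ‖ψ‖ ^ 2 * ‖v (δ.act g z)‖ ^ 2 ∂(normalizedHaar G) := by
          let _ : MeasurableSpace G := borel G
          refine integral_mono (integrable_normalizedHaar (by fun_prop))
            (integrable_normalizedHaar (by fun_prop)) fun g => ?_
          simp only [norm_smul, mul_pow]
          gcongr
          exact ψ.norm_coe_le_norm g
      _ = ‖ψ‖ ^ 2 * ‖j z‖ ^ 2 := by rw [integral_const_mul, h2]
      _ ≤ (‖ψ‖ * ε) ^ 2 := by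
          rw [mul_pow]
          gcongr
          exact hz ρ j hj
  exact (sq_le_sq₀ (norm_nonneg _) (by positivity)).1 h3

/-- Smoothing by `ψ` preserves `W` and turns approximation in the representations into norm
approximation; concentrating `ψ` at the identity then recovers `x`. -/
theorem mem_of_forall_exists_norm_sub_le (hι : ∀ g c, ι (β.act g c) = δ.act g (ι c))
    {W : Submodule ℂ A} (hWc : IsClosed (W : Set A)) (hWδ : ∀ g, ∀ x ∈ W, δ.act g x ∈ W) {x : A}
    (hx : ∀ ε : ℝ, 0 < ε → ∃ y ∈ W, ∀ (ρ : CovariantRep β) (j : A →L[ℂ] ρ.H),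
      Intertwines δ ι ρ j → ‖j x - j y‖ ≤ ε) : x ∈ W := by
  have hconv : Convex ℝ (W : Set A) := (W.restrictScalars ℝ).convex
  have hψ : ∀ ψ : C(G, ℂ), ∫ g, ψ g • δ.act g x ∂(normalizedHaar G) ∈ W := by
    intro ψ
    refine hWc.closure_subset (Metric.mem_closure_iff.2 fun ε hε => ?_)
    obtain ⟨y, hy, h⟩ := hx (ε / 2 / (‖ψ‖ + 1)) (by positivity)
    have hc : ∀ a, Continuous fun g => ψ g • δ.act g a := fun a =>
      ψ.continuous.smul (δ.continuous_act a)
    refine ⟨_, integral_normalizedHaar_mem hconv hWc (hc y) fun g =>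
      W.smul_mem _ (hWδ g y hy), ?_⟩
    have := norm_integral_smul_act_le (z := x - y) hι ψ (ε := ε / 2 / (‖ψ‖ + 1)) (by positivity)
      fun ρ j hj => by rw [map_sub]; exact h ρ j hj
    rw [dist_eq_norm]
    simp_rw [map_sub, smul_sub] at this
    let _ : MeasurableSpace G := borel G
    rw [integral_sub (integrable_normalizedHaar (hc x)) (integrable_normalizedHaar (hc y))] at this
    refine this.trans_lt ?_
    rw [mul_div_assoc', div_lt_iff₀ (by positivity)]
    nlinarith [norm_nonneg ψ]
  refine hWc.closure_subset (Metric.mem_closure_iff.2 fun ε hε => ?_)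
  obtain ⟨ψ, h⟩ := exists_integral_smul_near (δ.continuous_act x) (half_pos hε)
  rw [act_one_apply] at h
  exact ⟨_, hψ ψ, by rw [dist_comm, dist_eq_norm]; linarith⟩

/-- An invariant C*-subalgebra that contains the fixed points and on which the action is saturated
is the whole algebra. -/
theorem surjective_of_isSaturated (hι : ∀ g c, ι (β.act g c) = δ.act g (ι c))
    (hr : IsClosed (Set.range ι)) (hfix : ∀ a ∈ δ.fixedAlgebra ⊤, a ∈ Set.range ι)
    (hβ : β.IsSaturated) : Function.Surjective ι := by
  let W : Submodule ℂ A :=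
    { carrier := Set.range ι
      add_mem' := by rintro _ _ ⟨c, rfl⟩ ⟨d, rfl⟩; exact ⟨c + d, map_add ι c d⟩
      zero_mem' := ⟨0, map_zero ι⟩
      smul_mem' := by rintro r _ ⟨c, rfl⟩; exact ⟨r • c, map_smul ι r c⟩ }
  have hWc : IsClosed (W : Set A) := hr
  have hWδ : ∀ g, ∀ x ∈ W, δ.act g x ∈ W := by
    rintro g _ ⟨c, rfl⟩
    exact ⟨β.act g c, hι g c⟩
  have hWι : ∀ c, ∀ x ∈ W, ι c * x ∈ W := by
    rintro c _ ⟨d, rfl⟩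
    exact ⟨c * d, map_mul ι c d⟩
  have hW : ∀ x, δ.average x ∈ W := fun x => hfix _ (δ.average_mem_fixedAlgebra x)
  have hφ : ∀ (φ : C(G, ℂ)) (c : C) (x : A),
      ∫ g, φ g • (ι c * δ.act g x) ∂(normalizedHaar G) ∈ W := by
    intro φ c x
    -- The elementary tensor `φ ⊗ c` lies in the crossed product; this is where saturation enters.
    let f : C(G, C) := ⟨fun g => φ g • c, by fun_prop⟩
    have hf : β.universalForm f ∈ β.trivialCharacterIdeal := by
      change _ ∈ (β.trivialCharacterIdeal : Set (UniversalOperators β))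
      rw [hβ]
      exact subset_closure (NonUnitalStarAlgebra.subset_adjoin ℂ _ ⟨f, rfl⟩)
    refine mem_of_forall_exists_norm_sub_le hι hWc hWδ fun ε hε => ?_
    obtain ⟨y, hy, h⟩ := mapsApprox_of_mem_trivialCharacterIdeal hWc hWδ hWι hW hf x trivial ε hε
    refine ⟨y, hy, fun ρ j hj => ?_⟩
    have e : (β.universalForm f).eval ρ (j x)
        = j (∫ g, φ g • (ι c * δ.act g x) ∂(normalizedHaar G)) := by
      refine (hj.integratedForm_apply f x).trans ?_
      simp_rw [f, ContinuousMap.coe_mk, map_smul, smul_mul_assoc]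
    rw [← e]
    exact h ρ j hj
  have hmul : ∀ c x, ι c * x ∈ W := by
    intro c x
    refine hWc.closure_subset (Metric.mem_closure_iff.2 fun ε hε => ?_)
    obtain ⟨φ, h⟩ := exists_integral_smul_near
      (F := fun g => ι c * δ.act g x) (continuous_const.mul (δ.continuous_act x)) (half_pos hε)
    rw [act_one_apply] at h
    exact ⟨_, hφ φ c x, by rw [dist_comm, dist_eq_norm]; linarith⟩
  intro x
  change x ∈ W
  refine hWc.closure_subset (Metric.mem_closure_iff.2 fun ε hε => ?_)
  obtain ⟨e, h⟩ := δ.exists_norm_average_mul_sub_le x (half_pos hε)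
  obtain ⟨c, hc⟩ := hW e
  exact ⟨_, hc ▸ hmul c x, by rw [dist_comm, dist_eq_norm]; linarith⟩

end Approximation

/-! ### Passage to the quotient group, and the theorem. -/

section Quotient

variable {G : Type u} [Group G] [TopologicalSpace G] {A : Type v} [NonUnitalCStarAlgebra A]

instance isClosed_fixedAlgebra (δ : CStarAction G A) (K : Subgroup G) :
    IsClosed (δ.fixedAlgebra K : Set A) := by
  have : (δ.fixedAlgebra K : Set A) = ⋂ g ∈ K, {a | δ.actL g a = a} := by
    ext a
    simp only [Set.mem_iInter]
    rfl
  rw [this]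
  exact isClosed_biInter fun g _ => isClosed_eq (δ.actL g).continuous continuous_id

theorem isInvariant_fixedAlgebra (δ : CStarAction G A) (K : Subgroup G) [hK : K.Normal] :
    δ.IsInvariant (δ.fixedAlgebra K) := by
  intro g a ha k hk
  have h := ha _ (hK.conj_mem k hk g⁻¹)
  rw [inv_inv, act_mul_apply, act_mul_apply] at h
  rw [← δ.act_act_inv g (δ.act k _), h]

/-- The action of the quotient by a normal subgroup that acts trivially. -/
def descend (δ : CStarAction G A) (K : Subgroup G) [K.Normal] (hK : K ≤ δ.act.ker) :
    CStarAction (G ⧸ K) A where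
  act := QuotientGroup.lift K δ.act hK
  continuous_act := fun a => continuous_coinduced_dom.2 (δ.continuous_act a)

end Quotient

end CStarAction

theorem corollary9 {G : Type u} [Group G] [TopologicalSpace G] [IsTopologicalGroup G]
    [CompactSpace G] [T2Space G] {A : Type v} [NonUnitalCStarAlgebra A]
    (δ : CStarAction G A) (B : NonUnitalStarSubalgebra ℂ A) [IsClosed (B : Set A)]
    (hB : δ.IsInvariant B) (hfix : δ.fixedAlgebra ⊤ ≤ B) :
    ((δ.restrict B hB).IsSaturated → (δ.restrict B hB).IsFaithful → B = ⊤) ∧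
      ((δ.quotientRestrict B hB).IsSaturated → B = δ.fixedAlgebra (δ.fixator B hB)) := by
  have hBc : IsClosed (B : Set A) := inferInstance
  constructor
  · intro hsat _
    let ι : B →⋆ₙₐ[ℂ] A := NonUnitalStarSubalgebraClass.subtype B
    have hr : Set.range ι = B := Subtype.range_coe
    have := CStarAction.surjective_of_isSaturated (δ := δ) (ι := ι) (fun g c => rfl) (hr ▸ hBc)
      (fun a ha => hr ▸ hfix ha) hsat
    refine eq_top_iff.2 fun a _ => ?_
    obtain ⟨b, rfl⟩ := this a
    exact b.2
  · intro hsat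
    set K := δ.fixator B hB
    have hBK : B ≤ δ.fixedAlgebra K := fun b hb g hg => (δ.mem_fixator B hB g).1 hg b hb
    refine le_antisymm hBK fun a ha => ?_
    -- `K` is normal and fixes `A ^ K` pointwise, so `G ⧸ K` acts on `A ^ K`, compatibly with its
    -- action on `B`.
    let δK := (δ.restrict (δ.fixedAlgebra K) (δ.isInvariant_fixedAlgebra K)).descend K
      fun g hg => StarAlgEquiv.ext fun x => Subtype.ext (x.2 g hg)
    let ι : B →⋆ₙₐ[ℂ] δ.fixedAlgebra K := NonUnitalStarSubalgebra.inclusion hBK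
    have hr : Set.range ι = Subtype.val ⁻¹' (B : Set A) := by
      ext x
      exact ⟨by rintro ⟨b, rfl⟩; exact b.2, fun hx => ⟨⟨x, hx⟩, rfl⟩⟩
    have := CStarAction.surjective_of_isSaturated (δ := δK) (β := δ.quotientRestrict B hB) (ι := ι)
      (fun g c => by induction g using QuotientGroup.induction_on with | H g => rfl)
      (hr ▸ hBc.preimage continuous_subtype_val)
      -- An element of `A ^ K` fixed by `G ⧸ K` is fixed by all of `G`, hence lies in `B`.
      (fun x hx => hr ▸ hfix fun g _ => congrArg Subtype.val (hx (g : G ⧸ K) trivial)) hsat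
    obtain ⟨b, hb⟩ := this ⟨a, ha⟩
    have hba : (b : A) = a := congrArg Subtype.val hb
    exact hba ▸ b.2
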